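/- Let $(\Omega,\mathcal F,P)$ be a probability space, $K=\mathbb R$ or $\mathbb C$, and let $L^0(\mathcal F,K)$ be the algebra of almost-sure equivalence classes of $K$-valued random variables; inequalities between such classes are understood almost surely. A *random normed module* over $K$ with base $(\Omega,\mathcal F,P)$ is a $K$-vector space $S$ that is also a module over the algebra $L^0(\mathcal F,K)$, with a map $\|\cdot\|:S\to L^0(\mathcal F,\mathbb R)$ such that, for all $x,y\in S$, $\alpha\in K$ and $\xi\in L^0(\mathcal F,K)$: $\|x\|\ge 0$, $\|\alpha x\|=|\alpha|\,\|x\|$, $\|\xi x\|=|\xi|\,\|x\|$, $\|x+y\|\le\|x\|+\|y\|$, and $\|x\|=0$ implies $x=0$. It is *complete* if it is complete in the linear topology for which the sets $\{x\in S: P(\|x\|<\eta)>1-\lambda\}$ ($\eta>0$, $0<\lambda<1$) form a local base at $0$. For $x,y\in S$ put $A_x=[\|x\|>0]$ and $B_{xy}=A_x\cap A_y\cap A_{x-y}$; inclusions of events are understood up to null sets. Let $S(1)$ be the set of $x\in S$ with $\|x\|=I_A$ for some $A\in\mathcal F$ with $P(A)>0$. The module $S$ is *random uniformly convex* if for each real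 $\varepsilon\in(0,2]$ there is a real $\delta\in(0,1)$ such that, for all $x,y\in S(1)$ and all $D\in\mathcal F$ with $D\subset B_{xy}$ and $P(D)>0$, if $\|x-y\|\ge\varepsilon$ a.s. on $D$, then $\left\|\frac{x+y}{2}\right\|\le 1-\delta$ a.s. on $D$. **Proposition.** Let $(S,\|\cdot\|)$ be a complete random uniformly convex random normed module over $K$ with base $(\Omega,\mathcal F,P)$, and let $1<p<\infty$. For each real $\varepsilon\in(0,2]$ there is a real number $\delta_p(\varepsilon)\in(0,1)$ such that, for all $x,y\in S$ and all $D\in\mathcal F$ with $D\subset B_{xy}$ and $P(D)>0$, if at least one of the conditions * (a) $\|x\|\le 1$, $\|y\|\le 1$ and $\|x-y\|\ge\varepsilon$ a.s. on $D$, * (c) $\|x-y\|\ge\varepsilon\,(\|x\|\vee\|y\|)$ a.s. on $D$ holds, then $$\left\|\frac{x+y}{2}\right\|^p\le(1-\delta_p(\varepsilon))\,\frac{\|x\|^p+\|y\|^p}{2}\quad\text{a.s. on } D.$$ -/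

import Mathlib

open MeasureTheory

noncomputable section

namespace RandomNormed

variable {K Ω S : Type*} [RCLike K] [MeasurableSpace Ω] {P : Measure Ω}

/-- `L⁰(ℱ, K)` is a commutative ring, with the pointwise (almost everywhere) operations. -/
instance instCommRingL0 : CommRing (Ω →ₘ[P] K) :=
  { (inferInstance : AddCommGroup (Ω →ₘ[P] K)), (inferInstance : CommMonoid (Ω →ₘ[P] K)) with
    left_distrib := fun a b c => AEEqFun.toGerm_injective (by
      simp only [AEEqFun.mul_toGerm, AEEqFun.add_toGerm, mul_add])
    right_distrib := fun a b c => AEEqFun.toGerm_injective (by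
      simp only [AEEqFun.mul_toGerm, AEEqFun.add_toGerm, add_mul])
    zero_mul := fun a => AEEqFun.toGerm_injective (by
      simp only [AEEqFun.mul_toGerm, AEEqFun.zero_toGerm, zero_mul])
    mul_zero := fun a => AEEqFun.toGerm_injective (by
      simp only [AEEqFun.mul_toGerm, AEEqFun.zero_toGerm, mul_zero]) }

/-- The modulus `|ξ|` of (the class of) a `K`-valued random variable, as an element of `L⁰(ℱ, ℝ)`. -/
def modulus (ξ : Ω →ₘ[P] K) : Ω →ₘ[P] ℝ :=
  ξ.comp (fun k : K => ‖k‖) continuous_norm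

/-- `N : S → L⁰(ℱ, ℝ)` is an `L⁰`-norm, so that `(S, N)` is a random normed module over `K` with
base `(Ω, ℱ, P)`. Here `S` is a vector space over `K` and a module over the algebra `L⁰(ℱ, K)`,
and `IsScalarTower` says that `α • x` is the product of `x` with the constant class `α`. -/
structure IsL0Norm (K : Type*) [RCLike K] [AddCommGroup S] [Module K S]
    [Module (Ω →ₘ[P] K) S] [IsScalarTower K (Ω →ₘ[P] K) S] (N : S → Ω →ₘ[P] ℝ) : Prop where
  nonneg : ∀ x, 0 ≤ N x
  norm_smul : ∀ (α : K) (x : S), N (α • x) = ‖α‖ • N x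
  add_le : ∀ x y, N (x + y) ≤ N x + N y
  eq_zero : ∀ x, N x = 0 → x = 0
  norm_L0_smul : ∀ (ξ : Ω →ₘ[P] K) (x : S), N (ξ • x) = modulus ξ * N x

/-- The basic neighbourhood `N(ε, l) = {x | P(‖x‖ < ε) > 1 - l}` of `0` in the
`(ε, λ)`-topology. -/
def basicNhd (N : S → Ω →ₘ[P] ℝ) (ε l : ℝ) : Set S :=
  {x | 1 - l < P.real {ω | N x ω < ε}}

/-- Completeness for the `(ε, λ)`-topology. This topology is a metrizable linear topology, so
completeness means that each Cauchy sequence converges. -/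
def IsCompleteRN [AddCommGroup S] (N : S → Ω →ₘ[P] ℝ) : Prop :=
  ∀ u : ℕ → S,
    (∀ ε l : ℝ, 0 < ε → 0 < l → l < 1 →
      ∃ n₀, ∀ m ≥ n₀, ∀ n ≥ n₀, u m - u n ∈ basicNhd N ε l) →
    ∃ x : S, ∀ ε l : ℝ, 0 < ε → 0 < l → l < 1 →
      ∃ n₀, ∀ n ≥ n₀, u n - x ∈ basicNhd N ε l

/-- `A_x = [‖x‖ > 0]`. -/
def suppSet (N : S → Ω →ₘ[P] ℝ) (x : S) : Set Ω := {ω | 0 < N x ω}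

/-- `B_{xy} = A_x ∩ A_y ∩ A_{x-y}`. -/
def B [AddCommGroup S] (N : S → Ω →ₘ[P] ℝ) (x y : S) : Set Ω :=
  suppSet N x ∩ suppSet N y ∩ suppSet N (x - y)

/-- The random unit sphere `S(1)`: the `x` with `‖x‖ = I_A` for some `A ∈ ℱ` with `P(A) > 0`. -/
def unitSphere (N : S → Ω →ₘ[P] ℝ) : Set S :=
  {x | ∃ A : Set Ω, MeasurableSet A ∧ 0 < P A ∧ N x =ᵐ[P] A.indicator (fun _ => (1 : ℝ))}

/-- Random uniform convexity: for each real `ε ∈ (0, 2]` there is a real `δ ∈ (0, 1)` such that,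
for all `x, y ∈ S(1)` and all `D ⊂ B_{xy}` with `P(D) > 0`, if `‖x - y‖ ≥ ε` on `D` then
`‖(x + y) / 2‖ ≤ 1 - δ` on `D`. (`D ⊂ B_{xy}` is inclusion up to a null set and "on `D`" means
almost surely on `D`.) -/
def IsRandomUniformlyConvex (K : Type*) [RCLike K] [AddCommGroup S] [Module K S]
    (N : S → Ω →ₘ[P] ℝ) : Prop :=
  ∀ ε : ℝ, 0 < ε → ε ≤ 2 → ∃ δ : ℝ, 0 < δ ∧ δ < 1 ∧
    ∀ x ∈ unitSphere N, ∀ y ∈ unitSphere N, ∀ D : Set Ω,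
      MeasurableSet D → 0 < P D → P (D \ B N x y) = 0 →
      (∀ᵐ ω ∂P, ω ∈ D → ε ≤ N (x - y) ω) →
      ∀ᵐ ω ∂P, ω ∈ D → N ((2⁻¹ : K) • (x + y)) ω ≤ 1 - δ

end RandomNormed

end

/-!
Condition (a) implies condition (c), so only (c) matters. Write `a = ‖x‖`, `b = ‖y‖`. Dividing by
the random norm gives `u`, `v` with `x = a u`, `y = b v`, `‖u‖ = I_{A_x}` and `‖v‖ = I_{A_y}`
(`IsL0Norm.exists_normalization`), and the triangle inequality for
`x - y = a (u - v) + (a - b) v` and `x + y = b (u + v) + (a - b) u` compares the random norms of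
`x ∓ y` with those of `u ∓ v`. What remains is a statement on real numbers, valid at almost every
`ω ∈ D` (`exists_midpoint_rpow_le`). By symmetry let `b ≤ a`.

* If `b / a` stays away from `1`, strict convexity of `t ↦ t ^ p` and compactness give a uniform
  gain already in `((a + b) / 2) ^ p ≤ (a ^ p + b ^ p) / 2` (`exists_uniform_midpoint_gap`).
* If `b / a` is close to `1`, then `‖u - v‖ ≥ ε / 2`, and random uniform convexity, applied to
  `u`, `v` on the event `D ∩ [‖u - v‖ ≥ ε / 2]`, gives the gain in `‖x + y‖ ≤ a + b`.
-/

open MeasureTheory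

namespace RandomNormed

/-! ### Inequalities for real numbers -/

theorem midpoint_rpow_le {p a b : ℝ} (hp : 1 < p) (ha : 0 ≤ a) (hb : 0 ≤ b) :
    ((a + b) / 2) ^ p ≤ (a ^ p + b ^ p) / 2 := by
  have h := (convexOn_rpow hp.le).2 (Set.mem_Ici.2 ha) (Set.mem_Ici.2 hb)
    (by norm_num : (0 : ℝ) ≤ 1 / 2) (by norm_num : (0 : ℝ) ≤ 1 / 2) (by norm_num)
  simp only [smul_eq_mul] at h
  rw [show (a + b) / 2 = 1 / 2 * a + 1 / 2 * b by ring]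
  linarith

/-- The midpoint inequality for `t ↦ t ^ p` at `1` and `t` is uniformly strict for `t` away
from `1`. -/
theorem exists_uniform_midpoint_gap {p τ : ℝ} (hp : 1 < p) (hτ0 : 0 ≤ τ) (hτ1 : τ < 1) :
    ∃ η : ℝ, 0 < η ∧ ∀ t : ℝ, 0 ≤ t → t ≤ τ →
      ((1 + t) / 2) ^ p ≤ (1 - η) * ((1 + t ^ p) / 2) := by
  have hp0 : 0 ≤ p := by linarith
  have hcont : Continuous fun t : ℝ => (1 + t ^ p) / 2 - ((1 + t) / 2) ^ p := by
    have h1 : Continuous fun t : ℝ => t ^ p := Real.continuous_rpow_const hp0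
    have h2 : Continuous fun t : ℝ => ((1 + t) / 2) ^ p := h1.comp (by fun_prop)
    fun_prop
  obtain ⟨t₀, ht₀, hmin⟩ := (isCompact_Icc (a := (0 : ℝ)) (b := τ)).exists_isMinOn
    ⟨0, le_rfl, hτ0⟩ hcont.continuousOn
  refine ⟨(1 + t₀ ^ p) / 2 - ((1 + t₀) / 2) ^ p, ?_, fun t h0 h1 => ?_⟩
  · have h := (strictConvexOn_rpow hp).2 (Set.mem_Ici.2 zero_le_one) (Set.mem_Ici.2 ht₀.1)
      (ht₀.2.trans_lt hτ1).ne' (by norm_num : (0 : ℝ) < 1 / 2) (by norm_num : (0 : ℝ) < 1 / 2)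
      (by norm_num)
    simp only [smul_eq_mul, Real.one_rpow] at h
    rw [show (1 + t₀) / 2 = 1 / 2 * 1 + 1 / 2 * t₀ by ring]
    linarith
  · have h := isMinOn_iff.1 hmin t ⟨h0, h1⟩
    have hc : 0 ≤ (1 + t₀ ^ p) / 2 - ((1 + t₀) / 2) ^ p := by
      have h' := midpoint_rpow_le hp zero_le_one ht₀.1
      rw [Real.one_rpow] at h'
      linarith
    have ht : t ^ p ≤ 1 := Real.rpow_le_one h0 (h1.trans hτ1.le) hp0
    nlinarith

/-- The pointwise form of the convexity estimate: `a`, `b`, `d`, `s` stand for the values of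
`‖x‖`, `‖y‖`, `‖x - y‖`, `‖(x + y) / 2‖`, and `r`, `m` for those of `‖u - v‖`, `‖(u + v) / 2‖`,
where `u`, `v` are the normalizations of `x`, `y`. -/
theorem exists_midpoint_rpow_le {p ε δ₀ : ℝ} (hp : 1 < p) (hε0 : 0 < ε) (hε2 : ε ≤ 2)
    (hδ0 : 0 < δ₀) (hδ1 : δ₀ < 1) :
    ∃ δ : ℝ, 0 < δ ∧ δ < 1 ∧ ∀ a b d r s m : ℝ, 0 < a → 0 < b → 0 ≤ s →
      ε * max a b ≤ d → d ≤ a * r + |a - b| → d ≤ b * r + |a - b| →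
      s ≤ (a + b) / 2 → s ≤ a * m + |a - b| / 2 → s ≤ b * m + |a - b| / 2 →
      (ε / 2 ≤ r → m ≤ 1 - δ₀) → s ^ p ≤ (1 - δ) * ((a ^ p + b ^ p) / 2) := by
  obtain ⟨η, hη0, hη⟩ := exists_uniform_midpoint_gap (τ := 1 - ε / 4) hp
    (by linarith) (by linarith)
  have hp0 : 0 ≤ p := by linarith
  refine ⟨min η (δ₀ / 2), lt_min hη0 (by linarith),
    (min_le_right _ _).trans_lt (by linarith), ?_⟩
  intro a b d r s m ha hb hs hd hda hdb hs1 hsa hsb hm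
  wlog hab : b ≤ a generalizing a b
  · have := this b a hb ha (by rwa [max_comm]) (by rwa [abs_sub_comm]) (by rwa [abs_sub_comm])
      (by linarith) (by rwa [abs_sub_comm]) (by rwa [abs_sub_comm]) (le_of_not_ge hab)
    rwa [add_comm (a ^ p)]
  rw [max_eq_left hab] at hd
  rw [abs_of_nonneg (sub_nonneg.2 hab)] at hda hdb hsa hsb
  have hA : 0 ≤ (a ^ p + b ^ p) / 2 := by positivity
  rcases le_or_gt b ((1 - ε / 4) * a) with hfar | hnear
  · have ht := hη (b / a) (by positivity) ((div_le_iff₀ ha).2 hfar)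
    have e1 : (a + b) / 2 = a * ((1 + b / a) / 2) := by field_simp
    have e2 : b ^ p = a ^ p * (b / a) ^ p := by
      rw [← Real.mul_rpow ha.le (by positivity)]
      congr 1
      field_simp
    calc s ^ p ≤ ((a + b) / 2) ^ p := Real.rpow_le_rpow hs hs1 hp0
      _ = a ^ p * ((1 + b / a) / 2) ^ p := by rw [e1, Real.mul_rpow ha.le (by positivity)]
      _ ≤ a ^ p * ((1 - η) * ((1 + (b / a) ^ p) / 2)) :=
        mul_le_mul_of_nonneg_left ht (by positivity)
      _ = (1 - η) * ((a ^ p + b ^ p) / 2) := by rw [e2]; ring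
      _ ≤ _ := mul_le_mul_of_nonneg_right (by linarith [min_le_left η (δ₀ / 2)]) hA
  · have hr : ε / 2 ≤ r := by
      have : a * (ε / 2) ≤ a * r := by nlinarith
      exact le_of_mul_le_mul_left this ha
    have hba : a ≤ 3 * b := by nlinarith
    have hs2 : s ≤ (1 - δ₀ / 2) * ((a + b) / 2) := by nlinarith [hm hr]
    have hc : (1 - δ₀ / 2) ^ p ≤ 1 - δ₀ / 2 := by
      simpa using Real.rpow_le_rpow_of_exponent_ge (by linarith : 0 < 1 - δ₀ / 2)
        (by linarith) hp.le
    calc s ^ p ≤ ((1 - δ₀ / 2) * ((a + b) / 2)) ^ p := Real.rpow_le_rpow hs hs2 hp0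
      _ = (1 - δ₀ / 2) ^ p * ((a + b) / 2) ^ p :=
        Real.mul_rpow (by linarith) (by positivity)
      _ ≤ (1 - δ₀ / 2) * ((a ^ p + b ^ p) / 2) :=
        mul_le_mul hc (midpoint_rpow_le hp ha.le hb.le) (by positivity) (by linarith)
      _ ≤ _ := mul_le_mul_of_nonneg_right (by linarith [min_le_right η (δ₀ / 2)]) hA

/-! ### Real random variables as scalars -/

/-- The element of `L⁰(ℱ, K)` given by a real random variable `f`. -/
noncomputable def realScalar (K : Type*) [RCLike K] {Ω : Type*} [MeasurableSpace Ω]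
    (P : Measure Ω) (f : Ω → ℝ) (hf : Measurable f) : Ω →ₘ[P] K :=
  AEEqFun.mk (fun ω => (f ω : K))
    (RCLike.continuous_ofReal.comp_stronglyMeasurable hf.stronglyMeasurable).aestronglyMeasurable

section

variable {K Ω S : Type*} [RCLike K] [MeasurableSpace Ω] {P : Measure Ω}

theorem realScalar_mul {f g : Ω → ℝ} (hf : Measurable f) (hg : Measurable g) :
    realScalar K P f hf * realScalar K P g hg = realScalar K P (f * g) (hf.mul hg) := by
  refine (AEEqFun.mk_mul_mk _ _ _ _).trans (AEEqFun.mk_eq_mk.2 ?_)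
  filter_upwards with ω
  simp

theorem realScalar_sub {f g : Ω → ℝ} (hf : Measurable f) (hg : Measurable g) :
    realScalar K P (f - g) (hf.sub hg) = realScalar K P f hf - realScalar K P g hg := by
  refine Eq.trans (AEEqFun.mk_eq_mk.2 ?_) (AEEqFun.mk_sub _ _ _ _)
  filter_upwards with ω
  simp

theorem realScalar_one : realScalar K P (fun _ => 1) measurable_const = 1 := by
  refine AEEqFun.mk_eq_mk.2 ?_
  filter_upwards with ω
  simp

theorem modulus_realScalar {f : Ω → ℝ} (hf : Measurable f) :
    modulus (realScalar K P f hf) =ᵐ[P] fun ω => |f ω| := by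
  unfold modulus realScalar
  rw [AEEqFun.comp_mk]
  refine (AEEqFun.coeFn_mk _ _).trans ?_
  filter_upwards with ω
  simp

/-! ### Random norms -/

theorem measurableSet_suppSet (N : S → Ω →ₘ[P] ℝ) (x : S) : MeasurableSet (suppSet N x) :=
  measurableSet_lt measurable_const (AEEqFun.measurable (N x))

variable [AddCommGroup S] [Module K S] [Module (Ω →ₘ[P] K) S] [IsScalarTower K (Ω →ₘ[P] K) S]
  {N : S → Ω →ₘ[P] ℝ}

theorem IsL0Norm.nonneg_ae (hN : IsL0Norm K N) (x : S) : ∀ᵐ ω ∂P, 0 ≤ N x ω := by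
  filter_upwards [AEEqFun.coeFn_le.2 (hN.nonneg x), AEEqFun.coeFn_zero (α := Ω) (β := ℝ) (μ := P)]
    with ω h h0
  rwa [h0] at h

theorem IsL0Norm.add_le_ae (hN : IsL0Norm K N) (x y : S) :
    ∀ᵐ ω ∂P, N (x + y) ω ≤ N x ω + N y ω := by
  filter_upwards [AEEqFun.coeFn_le.2 (hN.add_le x y), AEEqFun.coeFn_add (N x) (N y)] with ω h h1
  rwa [h1] at h

theorem IsL0Norm.half_smul_ae (hN : IsL0Norm K N) (x : S) :
    ∀ᵐ ω ∂P, N ((2⁻¹ : K) • x) ω = N x ω / 2 := by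
  filter_upwards [AEEqFun.coeFn_smul ‖(2⁻¹ : K)‖ (N x)] with ω h
  rw [hN.norm_smul, h]
  simp
  ring

theorem IsL0Norm.realScalar_smul_ae (hN : IsL0Norm K N) {f : Ω → ℝ} (hf : Measurable f) (x : S) :
    ∀ᵐ ω ∂P, N (realScalar K P f hf • x) ω = |f ω| * N x ω := by
  filter_upwards [AEEqFun.coeFn_mul (modulus (realScalar K P f hf)) (N x),
    modulus_realScalar (K := K) (P := P) hf] with ω h h1
  rw [hN.norm_L0_smul, h, Pi.mul_apply, h1]

theorem IsL0Norm.eq_zero_of_ae (hN : IsL0Norm K N) {x : S} (h : ∀ᵐ ω ∂P, N x ω = 0) : x = 0 := by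
  refine hN.eq_zero x (AEEqFun.ext ?_)
  filter_upwards [h, AEEqFun.coeFn_zero (α := Ω) (β := ℝ) (μ := P)] with ω h h0
  rw [h, h0]
  rfl

/-- Polar decomposition: `x = ‖x‖ u`, where `‖u‖` is the indicator of `[‖x‖ > 0]`. -/
theorem IsL0Norm.exists_normalization (hN : IsL0Norm K N) (x : S) :
    ∃ u : S, x = realScalar K P (N x) (AEEqFun.measurable (N x)) • u ∧
      N u =ᵐ[P] (suppSet N x).indicator (fun _ => (1 : ℝ)) := by
  have hm := AEEqFun.measurable (N x)
  -- The convention `0⁻¹ = 0` makes `u` vanish outside `[‖x‖ > 0]`.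
  refine ⟨realScalar K P (N x)⁻¹ hm.inv • x, ?_, ?_⟩
  · rw [← mul_smul, realScalar_mul, ← sub_eq_zero]
    nth_rewrite 1 [← one_smul (Ω →ₘ[P] K) x]
    rw [← realScalar_one, ← sub_smul, ← realScalar_sub]
    refine hN.eq_zero_of_ae ?_
    filter_upwards [hN.realScalar_smul_ae
      (measurable_const.sub (hm.mul hm.inv) :
        Measurable ((fun _ => (1 : ℝ)) - (N x : Ω → ℝ) * (N x : Ω → ℝ)⁻¹)) x] with ω h
    rw [h]
    by_cases h0 : N x ω = 0 <;> simp [h0]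
  · filter_upwards [hN.realScalar_smul_ae hm.inv x, hN.nonneg_ae x] with ω h h0
    rw [h]
    rcases h0.eq_or_lt with h1 | h1
    · rw [Set.indicator_of_notMem (by simp [suppSet, ← h1]), ← h1, mul_zero]
    · rw [Set.indicator_of_mem (show ω ∈ suppSet N x from h1), Pi.inv_apply,
        abs_of_pos (inv_pos.2 h1), inv_mul_cancel₀ h1.ne']

theorem IsL0Norm.sub_le_of_smul (hN : IsL0Norm K N) {f g : Ω → ℝ} (hf : Measurable f)
    (hg : Measurable g) (u v : S) :
    ∀ᵐ ω ∂P, N (realScalar K P f hf • u - realScalar K P g hg • v) ω ≤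
      |f ω| * N (u - v) ω + |f ω - g ω| * N v ω := by
  have e : realScalar K P f hf • u - realScalar K P g hg • v =
      realScalar K P f hf • (u - v) + realScalar K P (f - g) (hf.sub hg) • v := by
    rw [realScalar_sub hf hg, smul_sub, sub_smul]
    abel
  rw [e]
  filter_upwards [hN.add_le_ae (realScalar K P f hf • (u - v))
    (realScalar K P (f - g) (hf.sub hg) • v), hN.realScalar_smul_ae hf (u - v),
    hN.realScalar_smul_ae (hf.sub hg) v] with ω h h1 h2
  rwa [h1, h2] at h

theorem IsL0Norm.add_le_of_smul (hN : IsL0Norm K N) {f g : Ω → ℝ} (hf : Measurable f)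
    (hg : Measurable g) (u v : S) :
    ∀ᵐ ω ∂P, N (realScalar K P f hf • u + realScalar K P g hg • v) ω ≤
      |g ω| * N (u + v) ω + |f ω - g ω| * N u ω := by
  have e : realScalar K P f hf • u + realScalar K P g hg • v =
      realScalar K P g hg • (u + v) + realScalar K P (f - g) (hf.sub hg) • u := by
    rw [realScalar_sub hf hg, smul_add, sub_smul]
    abel
  rw [e]
  filter_upwards [hN.add_le_ae (realScalar K P g hg • (u + v))
    (realScalar K P (f - g) (hf.sub hg) • u), hN.realScalar_smul_ae hg (u + v),
    hN.realScalar_smul_ae (hf.sub hg) u] with ω h h1 h2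
  rwa [h1, h2] at h

theorem IsL0Norm.sub_comm (hN : IsL0Norm K N) (x y : S) : N (x - y) = N (y - x) := by
  have h := hN.norm_smul (-1) (y - x)
  simpa using h

end

end RandomNormed

open RandomNormed in
theorem proposition3p2 {K Ω S : Type*} [RCLike K] [MeasurableSpace Ω]
    (P : Measure Ω) [IsProbabilityMeasure P]
    [AddCommGroup S] [Module K S] [Module (Ω →ₘ[P] K) S] [IsScalarTower K (Ω →ₘ[P] K) S]
    (N : S → Ω →ₘ[P] ℝ) (hN : RandomNormed.IsL0Norm K N)
    (hcomplete : RandomNormed.IsCompleteRN N)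
    (hconvex : RandomNormed.IsRandomUniformlyConvex K N)
    (p : ℝ) (hp : 1 < p) (ε : ℝ) (hε0 : 0 < ε) (hε2 : ε ≤ 2) :
    ∃ δ : ℝ, 0 < δ ∧ δ < 1 ∧
      ∀ (x y : S) (D : Set Ω), MeasurableSet D → 0 < P D →
        P (D \ RandomNormed.B N x y) = 0 →
        ((∀ᵐ ω ∂P, ω ∈ D → N x ω ≤ 1 ∧ N y ω ≤ 1 ∧ ε ≤ N (x - y) ω) ∨
          (∀ᵐ ω ∂P, ω ∈ D → ε * max (N x ω) (N y ω) ≤ N (x - y) ω)) →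
        ∀ᵐ ω ∂P, ω ∈ D →
          (N ((2⁻¹ : K) • (x + y)) ω) ^ p ≤ (1 - δ) * (((N x ω) ^ p + (N y ω) ^ p) / 2) := by
  obtain ⟨δ₀, hδ0, hδ1, hδ⟩ := hconvex (ε / 2) (by linarith) (by linarith)
  obtain ⟨δ, hδpos, hδlt, hreal⟩ := exists_midpoint_rpow_le hp hε0 hε2 hδ0 hδ1
  refine ⟨δ, hδpos, hδlt, fun x y D hD hPD hDB hcond => ?_⟩
  have hc : ∀ᵐ ω ∂P, ω ∈ D → ε * max (N x ω) (N y ω) ≤ N (x - y) ω := by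
    rcases hcond with h | h
    · filter_upwards [h] with ω h hω
      obtain ⟨h1, h2, h3⟩ := h hω
      nlinarith [max_le h1 h2]
    · exact h
  have hsupp : ∀ᵐ ω ∂P, ω ∈ D → ω ∈ B N x y := by
    filter_upwards [measure_eq_zero_iff_ae_notMem.1 hDB] with ω h hω
    by_contra hB
    exact h ⟨hω, hB⟩
  obtain ⟨u, hxu, hu⟩ := hN.exists_normalization x
  obtain ⟨v, hyv, hv⟩ := hN.exists_normalization y
  have hconv : ∀ᵐ ω ∂P, ω ∈ D → ε / 2 ≤ N (u - v) ω →
      N ((2⁻¹ : K) • (u + v)) ω ≤ 1 - δ₀ := by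
    -- Random uniform convexity speaks only of events of positive probability, so `P E = 0` is
    -- treated separately.
    let E : Set Ω := D ∩ {ω | ε / 2 ≤ N (u - v) ω}
    have hEm : MeasurableSet E :=
      hD.inter (measurableSet_le measurable_const (AEEqFun.measurable _))
    rcases eq_or_ne (P E) 0 with h0 | h0
    · filter_upwards [measure_eq_zero_iff_ae_notMem.1 h0] with ω h hω h'
      exact absurd ⟨hω, h'⟩ h
    have hpos : ∀ w : S, (∀ᵐ ω ∂P, ω ∈ D → ω ∈ suppSet N w) → 0 < P (suppSet N w) :=
      fun w hw => hPD.trans_le (measure_mono_ae hw)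
    have hsx : 0 < P (suppSet N x) := hpos x (hsupp.mono fun ω h hω => (h hω).1.1)
    have hsy : 0 < P (suppSet N y) := hpos y (hsupp.mono fun ω h hω => (h hω).1.2)
    have hEB : P (E \ B N u v) = 0 := by
      refine measure_eq_zero_iff_ae_notMem.2 ?_
      filter_upwards [hsupp, hu, hv] with ω h hu hv hω
      obtain ⟨⟨hωD, hωr⟩, hωB⟩ := hω
      have hB := h hωD
      rw [Set.indicator_of_mem hB.1.1] at hu
      rw [Set.indicator_of_mem hB.1.2] at hv
      refine hωB ⟨⟨?_, ?_⟩, ?_⟩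
      · simp [suppSet, hu]
      · simp [suppSet, hv]
      · exact (half_pos hε0).trans_le hωr
    filter_upwards [hδ u ⟨_, measurableSet_suppSet N x, hsx, hu⟩
      v ⟨_, measurableSet_suppSet N y, hsy, hv⟩ E hEm (pos_iff_ne_zero.2 h0) hEB
      (Filter.Eventually.of_forall fun ω hω => hω.2)] with ω h hω h'
    exact h ⟨hω, h'⟩
  have hmx := AEEqFun.measurable (N x)
  have hmy := AEEqFun.measurable (N y)
  have hd1 := hN.sub_le_of_smul hmx hmy u v
  have hd2 := hN.sub_le_of_smul hmy hmx v u
  have hs1 := hN.add_le_of_smul hmx hmy u v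
  have hs2 := hN.add_le_of_smul hmy hmx v u
  rw [← hxu, ← hyv] at hd1 hd2 hs1 hs2
  rw [hN.sub_comm y x, hN.sub_comm v u] at hd2
  rw [add_comm y x, add_comm v u] at hs2
  filter_upwards [hc, hsupp, hu, hv, hconv, hd1, hd2, hs1, hs2, hN.add_le_ae x y,
    hN.half_smul_ae (x + y), hN.half_smul_ae (u + v), hN.nonneg_ae (x + y)]
    with ω hc hsupp hu hv hconv hd1 hd2 hs1 hs2 hadd hxy huv h0 hω
  obtain ⟨⟨ha, hb⟩, -⟩ := hsupp hω
  rw [Set.indicator_of_mem ha] at hu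
  rw [Set.indicator_of_mem hb] at hv
  have ha' : 0 < N x ω := ha
  have hb' : 0 < N y ω := hb
  rw [hv, abs_of_pos ha', mul_one] at hd1
  rw [hu, abs_of_pos hb', mul_one, abs_sub_comm] at hd2
  rw [hu, abs_of_pos hb', mul_one] at hs1
  rw [hv, abs_of_pos ha', mul_one, abs_sub_comm] at hs2
  have hconv' := hconv hω
  rw [huv] at hconv'
  rw [hxy]
  exact hreal _ _ _ _ _ _ ha' hb' (by linarith) (hc hω) hd1 hd2 (by linarith) (by linarith)
    (by linarith) hconv'
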